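/- Let $n\in\mathbb N$, let $L:\mathbb R^n\times\mathbb R^n\to[0,\infty)$ be lower semicontinuous, with $L(x,\cdot)$ convex for every $x$, and coercive: there is $\Theta:\mathbb R^n\to[0,\infty)$ with $\lim_{|u|\to\infty}\Theta(u)/|u|=+\infty$ and $L(x,u)\ge\Theta(u)$ for all $(x,u)$. Let $\varphi:\mathbb R^n\to[0,+\infty]$ be lower semicontinuous and not identically $+\infty$. For $t\ge 0$, $x\in\mathbb R^n$ put $$V(t,x)=\inf\Big\{\int_0^t L(y(s),y'(s))\,ds+\varphi(y(t)) : y\in W^{1,1}(0,t;\mathbb R^n),\ y(0)=x\Big\}\in[0,+\infty],$$ and let $\mathrm{dom}(V)=\{V<+\infty\}$. For $(t,x)\in\mathrm{dom}(V)$ with $t>0$ let $$D_\uparrow V(t,x)(\tau,u)=\liminf_{h\to0+,\ (\tau',u')\to(\tau,u)}\frac{V(t+h\tau',x+hu')-V(t,x)}{h},$$ and let the subdifferential $\partial_-V(t,x)$ be the set of all $p=(p_t,p_x)\in\mathbb R\times\mathbb R^n$ with $$\liminf_{(s,z)\to(t,x)}\frac{V(s,z)-V(t,x)-p_t(s-t)-\langle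 p_x,z-x\rangle}{|(s,z)-(t,x)|}\ge0,$$ with $\partial_-V(t,x)=\emptyset$ if $V(t,x)=+\infty$. Let $H(x,p)=\sup_{u\in\mathbb R^n}(\langle p,u\rangle-L(x,u))$. Let $(t,x)\in\mathrm{dom}(V)$ with $t>0$, and let $y$ be a minimizer in the definition of $V(t,x)$. Assume either that $\partial_-V(t,x)\neq\emptyset$, or that $L$ satisfies $$\forall x_0\in\mathbb R^n\ \exists M>0\ \exists r>0\ \forall (\xi,u)\in \overline B(x_0,r)\times\overline B(0,r):\quad L(\xi,u)\le M .$$ Then the set $\{(y(h)-x)/h : 0<h\le t\}$ is bounded in $\mathbb R^n$. Furthermore, if $(y(h_i)-x)/h_i\to u$ for some sequence $h_i\to0+$, then $$D_\uparrow V(t,x)(-1,u)\le -L(x,u).$$ Consequently, $V$ is a viscosity supersolution of $V_t+H(x,-V_x)=0$, that is, for all $t>0$, all $x\in\mathbb R^n$ and all $(p_t,p_x)\in\partial_-V(t,x)$, $$p_t+H(x,-p_x)\ge0 .$$ -/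

import Mathlib

open Filter Topology MeasureTheory
open scoped ENNReal

namespace Bolza

/-- `ℝⁿ` with its Euclidean norm and inner product. -/
abbrev Space (n : ℕ) : Type := EuclideanSpace ℝ (Fin n)

/-- The coercivity condition of Tonelli type: `L x u ≥ Θ u` for some `Θ ≥ 0` with
`Θ u / |u| → +∞` as `|u| → ∞`. -/
def Coercive {n : ℕ} (L : Space n → Space n → ℝ) : Prop :=
  ∃ Θ : Space n → ℝ, (∀ u, 0 ≤ Θ u) ∧
    Tendsto (fun u => Θ u / ‖u‖) (Bornology.cobounded (Space n)) atTop ∧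
    ∀ x u, Θ u ≤ L x u

/-- Local boundedness of `L` near zero velocities: every `x₀` has a radius `r > 0` such that
`L` is bounded above on `B(x₀, r) × B(0, r)` (closed balls). -/
def LocallyBoundedNearZero {n : ℕ} (L : Space n → Space n → ℝ) : Prop :=
  ∀ x₀ : Space n, ∃ M : ℝ, 0 < M ∧ ∃ r : ℝ, 0 < r ∧
    ∀ x ∈ Metric.closedBall x₀ r, ∀ u ∈ Metric.closedBall (0 : Space n) r, L x u ≤ M

/-- `y` is an admissible trajectory for the initial data `(t, x)`: it is absolutely continuous on
`[0, t]` (that is, it lies in `W^{1,1}(0, t; ℝⁿ)`) and `y 0 = x`. Only the values of `y` on `[0, t]`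
matter. There is no admissible trajectory when `t < 0`. -/
def Admissible {n : ℕ} (t : ℝ) (x : Space n) (y : ℝ → Space n) : Prop :=
  0 ≤ t ∧ AbsolutelyContinuousOnInterval y 0 t ∧ y 0 = x

/-- The Bolza functional `∫₀ᵗ L(y(s), y'(s)) ds + φ(y(t))`, with values in `[0, ∞]`; the integrand
is nonnegative, and `y'(s)` exists for almost every `s ∈ (0, t)` when `y` is absolutely
continuous. -/
noncomputable def cost {n : ℕ} (L : Space n → Space n → ℝ) (φ : Space n → ℝ≥0∞) (t : ℝ)
    (y : ℝ → Space n) : ℝ≥0∞ :=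
  (∫⁻ s in Set.Ioc 0 t, ENNReal.ofReal (L (y s) (deriv y s))) + φ (y t)

/-- The value function `V(t, x)`, as an extended real valued function on `ℝ × ℝⁿ`
(equal to `+∞` for `t < 0`, by convention). -/
noncomputable def value {n : ℕ} (L : Space n → Space n → ℝ) (φ : Space n → ℝ≥0∞)
    (q : ℝ × Space n) : EReal :=
  ((⨅ (y : ℝ → Space n) (_ : Admissible q.1 q.2 y), cost L φ q.1 y : ℝ≥0∞) : EReal)

/-- `y` minimizes the Bolza functional among the admissible trajectories for `(t, x)`. -/
def IsMinimizer {n : ℕ} (L : Space n → Space n → ℝ) (φ : Space n → ℝ≥0∞) (t : ℝ) (x : Space n)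
    (y : ℝ → Space n) : Prop :=
  Admissible t x y ∧ ∀ z : ℝ → Space n, Admissible t x z → cost L φ t y ≤ cost L φ t z

/-- The lower contingent derivative
`D↑W(x)(u) = liminf_{h → 0+, v → u} (W(x + h v) - W(x)) / h`, meant for `W(x)` finite. -/
noncomputable def lowerContingentDeriv {X : Type*} [NormedAddCommGroup X] [NormedSpace ℝ X]
    (W : X → EReal) (x u : X) : EReal :=
  liminf (fun p : ℝ × X => (W (x + p.1 • p.2) - W x) / (p.1 : EReal)) (𝓝[>] (0 : ℝ) ×ˢ 𝓝 u)

/-- The subdifferential `∂₋W(t, x)` of an extended real valued function on `ℝ × ℝⁿ = ℝ^{1+n}`,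
written with the Euclidean inner product and norm of `ℝ^{1+n}`: the set of `p = (p_t, p_x)` with
`liminf_{q → (t,x)} (W(q) - W(t,x) - ⟨p, q - (t,x)⟩) / |q - (t,x)| ≥ 0`.
It is empty where `W` is infinite. -/
def subdifferential {n : ℕ} (W : ℝ × Space n → EReal) (t : ℝ) (x : Space n) :
    Set (ℝ × Space n) :=
  {p | W (t, x) ≠ ⊤ ∧ W (t, x) ≠ ⊥ ∧
    0 ≤ liminf (fun q : ℝ × Space n =>
      (W q - W (t, x) - ((p.1 * (q.1 - t) + inner ℝ p.2 (q.2 - x) : ℝ) : EReal)) /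
        ((Real.sqrt ((q.1 - t) ^ 2 + ‖q.2 - x‖ ^ 2) : ℝ) : EReal)) (𝓝[≠] (t, x))}

/-- The Hamiltonian `H(x, p) = sup_u (⟨p, u⟩ - L(x, u))`. -/
noncomputable def hamiltonian {n : ℕ} (L : Space n → Space n → ℝ) (x p : Space n) : EReal :=
  ⨆ u : Space n, ((inner ℝ p u - L x u : ℝ) : EReal)

end Bolza

/-!
The proof compares the value function `V` with itself along short pieces of (almost) optimal
curves. Dynamic programming gives `V(t - h, y(h)) + ∫₀ʰ L(y, y') ≤ V(t, x) + η` for every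
`η`-minimizer `y`, so everything reduces to bounds on the action over `[0, h]` as `h → 0+`.

*Lower bound.* Since `L` is lower semicontinuous, convex in the velocity and coercive, an affine
minorant of `L(x, ·)` that is `ε`-exact at `u` remains, up to a small error, a minorant of `L(z, ·)`
for all `z` near `x` (`exists_affine_minorant_near`). Integrating it along the curve gives
`(1/h) ∫₀ʰ L(y, y') ≥ L(x, u) - ε + o(1)` whenever the mean velocities `(y(h) - x)/h` tend to `u`
(`exists_mean_action_lower_bound`). With dynamic programming this is the inequality for
`D↑V(t, x)(-1, u)`.

*Bounded mean velocities.* If `p ∈ ∂₋V(t, x)`, the subgradient inequality at `(t - h, y(h))` bounds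
`∫₀ʰ L(y, y')` by `O(h + |y(h) - x|)`, while coercivity makes the action at least
`K |y(h) - x| - C h` with `K` as large as desired
(`exists_velocity_bound_of_mem_subdifferential`). If instead `L` is bounded near zero velocities,
the curve can be replaced on `[0, h]` by a segment at a fixed speed `r`; the time lost is at most
`|y(h) - x| / r`, and it is regained on `[t/2, t]` by speeding up on a set of positive measure where
`L(y, 2y')` is bounded, at a cost proportional to the time regained (`exists_time_saving`).
Optimality again bounds the action by `O(|y(h) - x|)`
(`exists_velocity_bound_of_locallyBounded`).

*Supersolution.* The argument with a subgradient is uniform over `h²`-minimizers, so no existence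
theorem for minimizers is needed: a limit point `u` of the mean velocities of `h²`-minimizers
satisfies `L(x, u) ≤ p_t - ⟨p_x, u⟩` (`exists_le_of_mem_subdifferential`).
-/

/-! ### Absolutely continuous curves -/

namespace AbsolutelyContinuousOnInterval

theorem comp_monotone_lipschitz {X : Type*} [PseudoMetricSpace X] {f : ℝ → X} {κ : ℝ → ℝ}
    {a b c d : ℝ} {K : NNReal} (hf : AbsolutelyContinuousOnInterval f c d) (hκ : Monotone κ)
    (hK : LipschitzWith K κ) (hmaps : Set.MapsTo κ (Set.uIcc a b) (Set.uIcc c d)) :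
    AbsolutelyContinuousOnInterval (fun s => f (κ s)) a b := by
  rw [absolutelyContinuousOnInterval_iff] at hf ⊢
  intro ε hε
  obtain ⟨δ, hδ, H⟩ := hf ε hε
  refine ⟨δ / (K + 1), by positivity, fun E hE hlen => ?_⟩
  refine H (E.1, fun i => (κ (E.2 i).1, κ (E.2 i).2)) ⟨fun i hi => ?_, ?_⟩ ?_
  · exact ⟨hmaps (hE.1 i hi).1, hmaps (hE.1 i hi).2⟩
  · intro i hi j hj hij
    have hdis := hE.2 hi hj hij
    simp only [Function.onFun] at hdis ⊢
    rw [Set.disjoint_left] at hdis ⊢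
    intro s hs hs'
    -- Disjointness of half-open intervals compares endpoints, which monotonicity preserves.
    simp only [Set.mem_uIoc] at hdis hs hs'
    have key : max (min (E.2 i).1 (E.2 i).2) (min (E.2 j).1 (E.2 j).2) <
        min (max (E.2 i).1 (E.2 i).2) (max (E.2 j).1 (E.2 j).2) := by
      refine hκ.reflect_lt ?_
      simp only [hκ.map_max, hκ.map_min]
      grind
    exact hdis (a := min (max (E.2 i).1 (E.2 i).2) (max (E.2 j).1 (E.2 j).2))
      (by grind) (by grind)
  · calc ∑ i ∈ Finset.range E.1, dist (κ (E.2 i).1) (κ (E.2 i).2)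
        ≤ ∑ i ∈ Finset.range E.1, K * dist (E.2 i).1 (E.2 i).2 :=
          Finset.sum_le_sum fun i _ => hK.dist_le_mul _ _
      _ = K * ∑ i ∈ Finset.range E.1, dist (E.2 i).1 (E.2 i).2 := by rw [Finset.mul_sum]
      _ ≤ K * (δ / (K + 1)) := by gcongr
      _ < δ := by
        rw [mul_div_assoc', div_lt_iff₀ (by positivity)]
        nlinarith

theorem lipschitz_comp {X Y : Type*} [PseudoMetricSpace X] [PseudoMetricSpace Y] {f : ℝ → X}
    {g : X → Y} {a b : ℝ} {K : NNReal} (hg : LipschitzWith K g)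
    (hf : AbsolutelyContinuousOnInterval f a b) :
    AbsolutelyContinuousOnInterval (fun s => g (f s)) a b := by
  unfold AbsolutelyContinuousOnInterval at hf ⊢
  refine squeeze_zero (fun E => Finset.sum_nonneg fun i _ => dist_nonneg) (fun E => ?_)
    (by simpa using Tendsto.const_mul (K : ℝ) hf)
  rw [Finset.mul_sum]
  exact Finset.sum_le_sum fun i _ => hg.dist_le_mul _ _

theorem congr {X : Type*} [PseudoMetricSpace X] {f g : ℝ → X} {a b : ℝ}
    (hf : AbsolutelyContinuousOnInterval f a b) (h : Set.EqOn f g (Set.uIcc a b)) :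
    AbsolutelyContinuousOnInterval g a b := by
  rw [absolutelyContinuousOnInterval_iff] at hf ⊢
  intro ε hε
  obtain ⟨δ, hδ, H⟩ := hf ε hε
  refine ⟨δ, hδ, fun E hE hlen => ?_⟩
  convert H E hE hlen using 1
  refine Finset.sum_congr rfl fun i hi => ?_
  rw [h (hE.1 i hi).1, h (hE.1 i hi).2]

/-- Gluing: `f = f (min · b) + f (max · b) - f b`, and each clamped function is a composition with
a monotone `1`-Lipschitz map. -/
theorem trans {F : Type*} [NormedAddCommGroup F] {f : ℝ → F} {a b c : ℝ} (hab : a ≤ b) (hbc : b ≤ c)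
    (h₁ : AbsolutelyContinuousOnInterval f a b) (h₂ : AbsolutelyContinuousOnInterval f b c) :
    AbsolutelyContinuousOnInterval f a c := by
  have hmin : AbsolutelyContinuousOnInterval (fun s => f (min s b)) a c := by
    refine h₁.comp_monotone_lipschitz (κ := fun s => min s b) (K := 1)
      (fun s s' h => min_le_min_right b h) (LipschitzWith.id.min_const b) ?_
    intro s hs
    rw [Set.uIcc_of_le (hab.trans hbc)] at hs
    rw [Set.uIcc_of_le hab]
    exact ⟨le_min hs.1 hab, min_le_right _ _⟩
  have hmax : AbsolutelyContinuousOnInterval (fun s => f (max s b)) a c := by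
    refine h₂.comp_monotone_lipschitz (κ := fun s => max s b) (K := 1)
      (fun s s' h => max_le_max_right b h) (LipschitzWith.id.max_const b) ?_
    intro s hs
    rw [Set.uIcc_of_le (hab.trans hbc)] at hs
    rw [Set.uIcc_of_le hbc]
    exact ⟨le_max_right _ _, max_le hs.2 hbc⟩
  have hconst : AbsolutelyContinuousOnInterval (fun _ : ℝ => f b) a c :=
    (LipschitzWith.const (f b)).lipschitzOnWith.absolutelyContinuousOnInterval
  refine ((hmin.add hmax).sub hconst).congr fun s _ => ?_
  rcases le_total s b with h | h
  · simp [h]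
  · simp [h]

theorem ae_hasDerivAt {F : Type*} [NormedAddCommGroup F] [NormedSpace ℝ F] [FiniteDimensional ℝ F]
    {f : ℝ → F} {a b : ℝ} (hf : AbsolutelyContinuousOnInterval f a b) :
    ∀ᵐ s, s ∈ Set.uIcc a b → HasDerivAt f (deriv f s) s := by
  filter_upwards [hf.boundedVariationOn.ae_differentiableAt_of_mem_uIcc] with s hs hmem
  exact (hs hmem).hasDerivAt

end AbsolutelyContinuousOnInterval

namespace Bolza

variable {n : ℕ}

/-! ### Curves of bounded action -/

/-- The action `∫₀ᵀ L(y, y')`, the running part of the Bolza functional. -/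
noncomputable def action (L : Space n → Space n → ℝ) (T : ℝ) (y : ℝ → Space n) : ℝ≥0∞ :=
  ∫⁻ s in Set.Ioc 0 T, ENNReal.ofReal (L (y s) (deriv y s))

/-- `Steerable L T a b c`: some absolutely continuous curve goes from `a` to `b` in time `T` with
action at most `c`. -/
def Steerable (L : Space n → Space n → ℝ) (T : ℝ) (a b : Space n) (c : ℝ≥0∞) : Prop :=
  0 ≤ T ∧ ∃ y : ℝ → Space n, AbsolutelyContinuousOnInterval y 0 T ∧ y 0 = a ∧ y T = b ∧
    action L T y ≤ c

theorem Steerable.trans {L : Space n → Space n → ℝ} {T₁ T₂ : ℝ} {a b d : Space n} {c₁ c₂ : ℝ≥0∞}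
    (h₁ : Steerable L T₁ a b c₁) (h₂ : Steerable L T₂ b d c₂) :
    Steerable L (T₁ + T₂) a d (c₁ + c₂) := by
  obtain ⟨hT₁, y, hy, hy0, hyT, hyc⟩ := h₁
  obtain ⟨hT₂, z, hz, hz0, hzT, hzc⟩ := h₂
  set w : ℝ → Space n := fun s => if s ≤ T₁ then y s else z (s - T₁) with hw
  have hw₁ : ∀ s, s ≤ T₁ → w s = y s := fun s hs => by simp [hw, hs]
  have hw₂ : ∀ s, T₁ ≤ s → w s = z (s - T₁) := by
    intro s hs
    rcases hs.eq_or_lt with rfl | hs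
    · simp [hw, hyT, hz0]
    · simp [hw, not_le.mpr hs]
  have hsh : AbsolutelyContinuousOnInterval (fun s => z (s - T₁)) T₁ (T₁ + T₂) := by
    refine hz.comp_monotone_lipschitz (κ := fun s => s - T₁) (K := 1)
      (fun s s' h => by simpa using h) ?_ ?_
    · exact LipschitzWith.of_dist_le_mul fun s s' => by simp
    · intro s hs
      rw [Set.uIcc_of_le (by linarith)] at hs ⊢
      exact ⟨by linarith [hs.1], by linarith [hs.2]⟩
  refine ⟨by linarith, w, ?_, ?_, ?_, ?_⟩
  · refine AbsolutelyContinuousOnInterval.trans hT₁ (by linarith) (hy.congr ?_) (hsh.congr ?_)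
    · intro s hs
      rw [Set.uIcc_of_le hT₁] at hs
      exact (hw₁ s hs.2).symm
    · intro s hs
      rw [Set.uIcc_of_le (by linarith)] at hs
      exact (hw₂ s hs.1).symm
  · rw [hw₁ 0 hT₁, hy0]
  · rw [hw₂ _ (by linarith), add_sub_cancel_left, hzT]
  · have hsplit : Set.Ioc 0 (T₁ + T₂) ⊆ Set.Ioc 0 T₁ ∪ Set.Ioc T₁ (T₁ + T₂) := by
      rw [Set.Ioc_union_Ioc_eq_Ioc hT₁ (by linarith)]
    have hd₁ : ∀ s, s < T₁ → deriv w s = deriv y s := fun s hs =>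
      Filter.EventuallyEq.deriv_eq (by
        filter_upwards [eventually_lt_nhds hs] with s' hs' using hw₁ s' hs'.le)
    have hd₂ : ∀ s, T₁ < s → deriv w s = deriv z (s - T₁) := fun s hs => by
      rw [← deriv_comp_sub_const z T₁ s]
      exact Filter.EventuallyEq.deriv_eq (by
        filter_upwards [eventually_gt_nhds hs] with s' hs' using hw₂ s' hs'.le)
    have e₁ : ∫⁻ s in Set.Ioc 0 T₁, ENNReal.ofReal (L (w s) (deriv w s)) = action L T₁ y := by
      unfold action
      rw [← restrict_Ioo_eq_restrict_Ioc]
      refine setLIntegral_congr_fun measurableSet_Ioo fun s hs => ?_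
      simp only [hw₁ s hs.2.le, hd₁ s hs.2]
    have e₂ : ∫⁻ s in Set.Ioc T₁ (T₁ + T₂), ENNReal.ofReal (L (w s) (deriv w s)) =
        action L T₂ z := by
      have : Set.Ioc 0 T₂ = (fun s => s - T₁) '' Set.Ioc T₁ (T₁ + T₂) := by
        rw [Set.image_sub_const_Ioc]; simp
      unfold action
      rw [this, lintegral_image_eq_lintegral_abs_deriv_mul (f' := fun _ => 1) measurableSet_Ioc
        (fun s _ => ((hasDerivAt_id' s).sub_const T₁).hasDerivWithinAt)
        (fun s _ s' _ h => by simpa using h)]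
      refine setLIntegral_congr_fun measurableSet_Ioc fun s hs => ?_
      simp only [hw₂ s hs.1.le, hd₂ s hs.1]
      simp
    calc action L (T₁ + T₂) w ≤ _ := lintegral_mono_set hsplit
      _ ≤ _ := lintegral_union_le _ _ _
      _ = action L T₁ y + action L T₂ z := by rw [e₁, e₂]
      _ ≤ c₁ + c₂ := add_le_add hyc hzc

theorem Steerable.of_subarc (L : Space n → Space n → ℝ) {T a b : ℝ} {y : ℝ → Space n}
    (hy : AbsolutelyContinuousOnInterval y 0 T) (ha : 0 ≤ a) (hab : a ≤ b) (hb : b ≤ T) :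
    Steerable L (b - a) (y a) (y b)
      (∫⁻ s in Set.Ioc a b, ENNReal.ofReal (L (y s) (deriv y s))) := by
  refine ⟨by linarith, fun s => y (s + a), ?_, by simp, by simp, ?_⟩
  · refine hy.comp_monotone_lipschitz (κ := fun s => s + a) (K := 1)
      (fun s s' h => by simpa using h) ?_ ?_
    · exact LipschitzWith.of_dist_le_mul fun s s' => by simp
    · intro s hs
      rw [Set.uIcc_of_le (by linarith)] at hs ⊢
      exact ⟨by linarith [hs.1], by linarith [hs.2]⟩
  · have : Set.Ioc a b = (fun s => s + a) '' Set.Ioc 0 (b - a) := by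
      rw [Set.image_add_const_Ioc]; simp
    unfold action
    rw [this, lintegral_image_eq_lintegral_abs_deriv_mul (f' := fun _ => 1) measurableSet_Ioc
      (fun s _ => ((hasDerivAt_id' s).add_const a).hasDerivWithinAt)
      (fun s _ s' _ h => by simpa using h)]
    refine (setLIntegral_congr_fun measurableSet_Ioc fun s hs => ?_).le
    simp [deriv_comp_add_const]

/-- A segment run through at constant speed `r`, staying where `L ≤ M` for speeds up to `r`. -/
theorem Steerable.segment {L : Space n → Space n → ℝ} {x b : Space n} {M r : ℝ} (hr : 0 < r)
    (hL : ∀ z ∈ Metric.closedBall x r, ∀ v ∈ Metric.closedBall (0 : Space n) r, L z v ≤ M)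
    (hb : ‖b - x‖ ≤ r) :
    Steerable L (‖b - x‖ / r) x b (ENNReal.ofReal (M * (‖b - x‖ / r))) := by
  rcases eq_or_ne b x with rfl | hne
  · refine ⟨by simp, fun _ => b,
      (LipschitzWith.const b).lipschitzOnWith.absolutelyContinuousOnInterval, rfl, rfl, ?_⟩
    simp [action]
  have hd : 0 < ‖b - x‖ := norm_pos_iff.mpr (sub_ne_zero.mpr hne)
  set T := ‖b - x‖ / r with hT
  have hT0 : 0 < T := by positivity
  set v : Space n := T⁻¹ • (b - x) with hv
  have hvn : ‖v‖ = r := by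
    rw [hv, norm_smul, norm_inv, Real.norm_of_nonneg hT0.le, hT]
    field_simp
  have hder : ∀ s, HasDerivAt (fun s : ℝ => x + s • v) v s := fun s => by
    simpa using ((hasDerivAt_id s).smul_const v).const_add x
  refine ⟨hT0.le, fun s => x + s • v, ?_, by simp, ?_, ?_⟩
  · refine LipschitzOnWith.absolutelyContinuousOnInterval (K := ‖v‖₊) ?_
    refine (LipschitzWith.of_dist_le_mul fun s s' => ?_).lipschitzOnWith
    rw [dist_add_left, dist_eq_norm, ← sub_smul, norm_smul, dist_eq_norm, mul_comm, coe_nnnorm]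
  · simp [hv, smul_smul, mul_inv_cancel₀ hT0.ne']
  · calc action L T (fun s => x + s • v) ≤ ∫⁻ _ in Set.Ioc 0 T, ENNReal.ofReal M := by
          refine setLIntegral_mono measurable_const fun s hs => ENNReal.ofReal_le_ofReal ?_
          rw [(hder s).deriv]
          refine hL _ ?_ _ (by simp [hvn])
          rw [Metric.mem_closedBall, dist_eq_norm, add_sub_cancel_left, norm_smul, hvn,
            Real.norm_of_nonneg hs.1.le]
          calc s * r ≤ T * r := by gcongr; exact hs.2
            _ = ‖b - x‖ := by rw [hT]; field_simp
            _ ≤ r := hb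
      _ = ENNReal.ofReal (M * T) := by
          rw [lintegral_const, Measure.restrict_apply_univ, Real.volume_Ioc, sub_zero,
            ENNReal.ofReal_mul' hT0.le]

/-- Jensen's inequality for an affine minorant: the fundamental theorem of calculus bounds the
action below by the minorant evaluated at the mean velocity. -/
theorem ofReal_le_action_of_affine_le {L : Space n → Space n → ℝ} {T a : ℝ} {y : ℝ → Space n}
    (hT : 0 ≤ T) (hy : AbsolutelyContinuousOnInterval y 0 T) (l : Space n →L[ℝ] ℝ)
    (hl : ∀ s ∈ Set.Ioc 0 T, ∀ v, a + l v ≤ L (y s) v) :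
    ENNReal.ofReal (a * T + l (y T - y 0)) ≤ action L T y := by
  have hly : AbsolutelyContinuousOnInterval (fun s => l (y s)) 0 T :=
    AbsolutelyContinuousOnInterval.lipschitz_comp l.lipschitz hy
  have hint : IntegrableOn (fun s => a + deriv (fun s => l (y s)) s) (Set.Ioc 0 T) := by
    have := hly.intervalIntegrable_deriv
    rw [intervalIntegrable_iff_integrableOn_Ioc_of_le hT] at this
    exact (integrable_const a).add this
  have heq : ∫ s in Set.Ioc 0 T, (a + deriv (fun s => l (y s)) s) = a * T + l (y T - y 0) := by
    rw [← intervalIntegral.integral_of_le hT, intervalIntegral.integral_add (by simp)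
      hly.intervalIntegrable_deriv, hly.integral_deriv_eq_sub]
    simp [mul_comm]
  calc ENNReal.ofReal (a * T + l (y T - y 0))
      ≤ ENNReal.ofReal (∫ s in Set.Ioc 0 T, max (a + deriv (fun s => l (y s)) s) 0) := by
        rw [← heq]
        exact ENNReal.ofReal_le_ofReal
          (integral_mono hint hint.pos_part fun s => le_max_left _ _)
    _ = ∫⁻ s in Set.Ioc 0 T, ENNReal.ofReal (max (a + deriv (fun s => l (y s)) s) 0) :=
        ofReal_integral_eq_lintegral_ofReal hint.pos_part
          (Eventually.of_forall fun s => le_max_right _ _)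
    _ ≤ action L T y := by
        refine lintegral_mono_ae ?_
        rw [ae_restrict_iff' measurableSet_Ioc]
        filter_upwards [hy.ae_hasDerivAt] with s hs hmem
        have hmem' : s ∈ Set.uIcc 0 T := by
          rw [Set.uIcc_of_le hT]; exact Set.Ioc_subset_Icc_self hmem
        have hd : deriv (fun s => l (y s)) s = l (deriv y s) :=
          (l.hasFDerivAt.comp_hasDerivAt s (hs hmem')).deriv
        rw [hd]
        rcases le_total (a + l (deriv y s)) 0 with h0 | h0
        · rw [max_eq_right h0]; simp
        · rw [max_eq_left h0]
          exact ENNReal.ofReal_le_ofReal (hl s hmem _)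

/-! ### Coercivity and affine minorants of the Lagrangian -/

theorem Coercive.exists_linear_lower_bound {L : Space n → Space n → ℝ} (hL : Coercive L) (K : ℝ)
    (hK : 0 ≤ K) : ∃ C : ℝ, 0 ≤ C ∧ ∀ z v, K * ‖v‖ - C ≤ L z v := by
  obtain ⟨Θ, hΘ0, hΘ, hΘL⟩ := hL
  have hev := hΘ.eventually_ge_atTop K
  rw [← comap_norm_atTop, eventually_comap] at hev
  obtain ⟨R, hR⟩ := eventually_atTop.mp hev
  refine ⟨K * max R 0, by positivity, fun z v => le_trans ?_ (hΘL z v)⟩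
  rcases le_or_gt ‖v‖ (max R 0) with h | h
  · have := mul_le_mul_of_nonneg_left h hK
    linarith [hΘ0 v]
  · have hv : 0 < ‖v‖ := lt_of_le_of_lt (le_max_right _ _) h
    have h1 := hR ‖v‖ ((le_max_left _ _).trans h.le) v rfl
    rw [le_div_iff₀ hv] at h1
    have : 0 ≤ K * max R 0 := by positivity
    linarith

/-- Apply the affine bound with the linear functional `K ⟪e, ·⟫`, `e` the direction of the
displacement. -/
theorem ofReal_displacement_le_action {L : Space n → Space n → ℝ} {T K C : ℝ} {y : ℝ → Space n}
    (hK : 0 ≤ K) (hL : ∀ z v, K * ‖v‖ - C ≤ L z v) (hT : 0 ≤ T)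
    (hy : AbsolutelyContinuousOnInterval y 0 T) :
    ENNReal.ofReal (K * ‖y T - y 0‖ - C * T) ≤ action L T y := by
  set d := y T - y 0 with hd
  set e : Space n := ‖d‖⁻¹ • d with he
  have hen : ‖e‖ ≤ 1 := by
    rw [he, norm_smul, norm_inv, norm_norm]
    exact inv_mul_le_one
  have hed : inner ℝ e d = ‖d‖ := by
    rw [he, real_inner_smul_left, real_inner_self_eq_norm_sq]
    rcases eq_or_ne ‖d‖ 0 with h | h
    · simp [h]
    · field_simp
  have := ofReal_le_action_of_affine_le (L := L) (a := -C) hT hy (K • innerSL ℝ e) (by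
    intro s _ v
    refine le_trans ?_ (hL (y s) v)
    have h1 : inner ℝ e v ≤ ‖v‖ := (real_inner_le_norm e v).trans
      (mul_le_of_le_one_left (norm_nonneg v) hen)
    have h2 := mul_le_mul_of_nonneg_left h1 hK
    simp only [smul_apply, innerSL_apply_apply, smul_eq_mul]
    linarith)
  rw [← hd] at this
  simp only [smul_apply, innerSL_apply_apply, smul_eq_mul, hed] at this
  convert this using 2
  ring

/-- An almost exact affine minorant of `L x` at `u` is, up to a further error, a minorant of `L z`
for all `z` near `x`: coercivity takes care of large velocities, lower semicontinuity and
compactness of the others. -/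
theorem exists_affine_minorant_near {L : Space n → Space n → ℝ}
    (hlsc : LowerSemicontinuous (fun q : Space n × Space n => L q.1 q.2))
    (hconv : ∀ x, ConvexOn ℝ Set.univ (L x)) (hco : Coercive L) (x u : Space n) {ε : ℝ}
    (hε : 0 < ε) :
    ∃ l : Space n →L[ℝ] ℝ, ∃ δ : ℝ, 0 < δ ∧
      ∀ z, ‖z - x‖ < δ → ∀ v, L x u - ε + l (v - u) ≤ L z v := by
  have hsec : LowerSemicontinuous (L x) := hlsc.comp (Continuous.prodMk_right x)
  obtain ⟨l, c, hlc, hlu⟩ := (hconv x).exists_affine_le_of_lt (𝕜 := ℝ) (Set.mem_univ u)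
    (a := L x u - ε / 2) (by linarith) isClosed_univ (hsec.lowerSemicontinuousOn _)
  have hlx : ∀ v, L x u - ε / 2 + l (v - u) ≤ L x v := by
    intro v
    have h1 := hlc ⟨v, Set.mem_univ v⟩
    simp at h1 hlu
    rw [map_sub]
    linarith
  obtain ⟨C, -, hC⟩ := hco.exists_linear_lower_bound (‖l‖ + 1) (by positivity)
  set R := C + L x u + ‖l‖ * ‖u‖ with hR
  set U : Set (Space n × Space n) := {q | L x u - ε < L q.1 q.2 + -l (q.2 - u)} with hU
  have hUo : IsOpen U := by
    have hcont : Continuous fun q : Space n × Space n => -l (q.2 - u) := by fun_prop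
    exact (hlsc.add hcont.lowerSemicontinuous).isOpen_preimage _
  obtain ⟨V, W, hV, -, hxV, hW, hVW⟩ := generalized_tube_lemma (isCompact_singleton (x := x))
    (isCompact_closedBall (0 : Space n) R) hUo (by
      rintro ⟨z, v⟩ ⟨hz, -⟩
      obtain rfl : z = x := hz
      have := hlx v
      simp only [hU, Set.mem_ofPred_eq]
      linarith)
  obtain ⟨δ, hδ, hδV⟩ := Metric.isOpen_iff.mp hV x (hxV rfl)
  refine ⟨l, δ, hδ, fun z hz v => ?_⟩
  rcases le_or_gt ‖v‖ R with h | h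
  · have : (z, v) ∈ U := hVW ⟨hδV (by rwa [Metric.mem_ball, dist_eq_norm]),
      hW (by simpa using h)⟩
    simp only [hU, Set.mem_ofPred_eq] at this
    linarith
  · have h1 := hC z v
    have h2 : l (v - u) ≤ ‖l‖ * (‖v‖ + ‖u‖) :=
      (le_abs_self _).trans ((l.le_opNorm _).trans
        (mul_le_mul_of_nonneg_left (norm_sub_le _ _) (norm_nonneg l)))
    nlinarith

/-! ### Reparametrization and time saving -/

/-- Change of variables for the action under a reparametrization `σ` with inverse `κ`. The
exceptional set where a derivative is missing is null, and so is its image as `σ` is Lipschitz. -/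
theorem lintegral_reparam_le {y : ℝ → Space n} {T : ℝ} {σ κ ρ : ℝ → ℝ} {K : NNReal}
    (F : Space n → Space n → ℝ≥0∞) (hT : 0 ≤ T) (hy : AbsolutelyContinuousOnInterval y 0 T)
    (hσ0 : σ 0 = 0) (hσ : StrictMono σ) (hσK : LipschitzWith K σ) (hκ : Continuous κ)
    (hκσ : ∀ s, κ (σ s) = s) (hσκ : ∀ s, σ (κ s) = s)
    (hρ : ∀ᵐ s, HasDerivAt σ (ρ s) s) (hρ0 : ∀ s, 0 < ρ s) :
    ∫⁻ s in Set.Ioc 0 (σ T), F (y (κ s)) (deriv (fun s => y (κ s)) s) ≤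
      ∫⁻ s in Set.Ioc 0 T, ENNReal.ofReal (ρ s) * F (y s) ((ρ s)⁻¹ • deriv y s) := by
  have hae : ∀ᵐ s, s ∈ Set.Ioc 0 T → HasDerivAt σ (ρ s) s ∧ HasDerivAt y (deriv y s) s := by
    filter_upwards [hρ, hy.ae_hasDerivAt] with s h1 h2 hs
    refine ⟨h1, h2 ?_⟩
    rw [Set.uIcc_of_le hT]
    exact Set.Ioc_subset_Icc_self hs
  obtain ⟨N, hN, hNm, hN0⟩ := exists_measurable_superset_of_null (ae_iff.mp hae)
  set S := Set.Ioc 0 T \ N with hS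
  have hSm : MeasurableSet S := measurableSet_Ioc.diff hNm
  have hgood : ∀ s ∈ S, HasDerivAt σ (ρ s) s ∧ HasDerivAt y (deriv y s) s := by
    intro s hs
    by_contra hcon
    exact hs.2 (hN (by
      simp only [Set.mem_ofPred_eq]
      exact fun h => hcon (h hs.1)))
  have himg : volume (σ '' N) = 0 := by
    have h1 := hσK.hausdorffMeasure_image_le (d := 1) zero_le_one N
    rw [hausdorffMeasure_real, hN0, mul_zero] at h1
    exact le_antisymm h1 zero_le
  have hcover : Set.Ioc 0 (σ T) ⊆ σ '' S ∪ σ '' N := by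
    intro s hs
    have hmem : κ s ∈ Set.Ioc 0 T := by
      constructor
      · rw [← hσ.lt_iff_lt, hσ0, hσκ]; exact hs.1
      · rw [← hσ.le_iff_le, hσκ]; exact hs.2
    by_cases h : κ s ∈ N
    · exact Or.inr ⟨κ s, h, hσκ s⟩
    · exact Or.inl ⟨κ s, ⟨hmem, h⟩, hσκ s⟩
  calc ∫⁻ s in Set.Ioc 0 (σ T), F (y (κ s)) (deriv (fun s => y (κ s)) s)
      ≤ ∫⁻ s in σ '' S ∪ σ '' N, F (y (κ s)) (deriv (fun s => y (κ s)) s) :=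
        lintegral_mono_set hcover
    _ ≤ (∫⁻ s in σ '' S, F (y (κ s)) (deriv (fun s => y (κ s)) s)) +
          ∫⁻ s in σ '' N, F (y (κ s)) (deriv (fun s => y (κ s)) s) := lintegral_union_le _ _ _
    _ = ∫⁻ s in σ '' S, F (y (κ s)) (deriv (fun s => y (κ s)) s) := by
        rw [setLIntegral_measure_zero _ _ himg, add_zero]
    _ = ∫⁻ s in S, ENNReal.ofReal |ρ s| *
          F (y (κ (σ s))) (deriv (fun s => y (κ s)) (σ s)) :=
        lintegral_image_eq_lintegral_abs_deriv_mul hSm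
          (fun s hs => (hgood s hs).1.hasDerivWithinAt) hσ.injective.injOn _
    _ = ∫⁻ s in S, ENNReal.ofReal (ρ s) * F (y s) ((ρ s)⁻¹ • deriv y s) := by
        refine setLIntegral_congr_fun hSm fun s hs => ?_
        have hκd : HasDerivAt κ (ρ s)⁻¹ (σ s) :=
          HasDerivAt.of_local_left_inverse hκ.continuousAt
            (by rw [hκσ]; exact (hgood s hs).1) (hρ0 s).ne' (Eventually.of_forall hσκ)
        have hzd : HasDerivAt (fun s => y (κ s)) ((ρ s)⁻¹ • deriv y s) (σ s) :=
          HasDerivAt.scomp (σ s) (by rw [hκσ]; exact (hgood s hs).2) hκd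
        simp only [hκσ, hzd.deriv, abs_of_pos (hρ0 s)]
    _ ≤ _ := lintegral_mono_set Set.sdiff_subset

/-- As `L` is finite, some set of times of positive measure has bounded `L(y, 2y')`. -/
theorem exists_measurable_bounded_double_speed {L : Space n → Space n → ℝ}
    (hlsc : LowerSemicontinuous (fun q : Space n × Space n => L q.1 q.2)) {T : ℝ} (hT : 0 < T)
    {y : ℝ → Space n} (hy : AbsolutelyContinuousOnInterval y 0 T) :
    ∃ (N : ℝ) (A : Set ℝ), 0 ≤ N ∧ MeasurableSet A ∧ A ⊆ Set.Ioc 0 T ∧ volume A ≠ 0 ∧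
      ∀ s ∈ A, L (y s) ((2 : ℝ) • deriv y s) ≤ N := by
  set μ := volume.restrict (Set.Ioc 0 T) with hμ
  set g : ℝ → ℝ := fun s => L (y s) ((2 : ℝ) • deriv y s) with hg
  have hym : AEMeasurable y μ := by
    have hc := hy.continuousOn
    rw [Set.uIcc_of_le hT.le] at hc
    exact (hc.mono Set.Ioc_subset_Icc_self).aemeasurable measurableSet_Ioc
  have hgm : AEMeasurable g μ :=
    hlsc.measurable.comp_aemeasurable
      (hym.prodMk ((measurable_deriv y).const_smul (2 : ℝ)).aemeasurable)
  obtain ⟨k, hk⟩ : ∃ k : ℕ, μ {s | g s ≤ k} ≠ 0 := by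
    by_contra! hcon
    have h1 : μ (⋃ k : ℕ, {s | g s ≤ k}) = 0 := measure_iUnion_null hcon
    have h2 : (⋃ k : ℕ, {s | g s ≤ k}) = Set.univ := by
      ext s
      simp only [Set.mem_iUnion, Set.mem_ofPred_eq, Set.mem_univ, iff_true]
      exact exists_nat_ge (g s)
    rw [h2, hμ, Measure.restrict_apply_univ, Real.volume_Ioc] at h1
    simp at h1
    linarith
  have hnull : NullMeasurableSet {s | g s ≤ k} μ := hgm.nullMeasurable measurableSet_Iic
  obtain ⟨B, hB, hBm, hBe⟩ := hnull.exists_measurable_subset_ae_eq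
  refine ⟨k, B ∩ Set.Ioc 0 T, k.cast_nonneg, hBm.inter measurableSet_Ioc, Set.inter_subset_right,
    ?_, fun s hs => hB hs.1⟩
  rw [← Measure.restrict_apply hBm, ← hμ, measure_congr hBe]
  exact hk

/-- Speeding up by `1 / (1 - θ)` on a set where `L(y, 2y')` is bounded saves time at a bounded
cost per unit of time: by convexity the extra cost on that set is at most `θ N` per unit time. -/
theorem exists_time_saving {L : Space n → Space n → ℝ} (hnn : ∀ x u, 0 ≤ L x u)
    (hlsc : LowerSemicontinuous (fun q : Space n × Space n => L q.1 q.2))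
    (hconv : ∀ x, ConvexOn ℝ Set.univ (L x)) {T : ℝ} (hT : 0 < T)
    {y : ℝ → Space n} (hy : AbsolutelyContinuousOnInterval y 0 T) :
    ∃ N τ₀ : ℝ, 0 ≤ N ∧ 0 < τ₀ ∧ ∀ τ, 0 ≤ τ → τ ≤ τ₀ →
      Steerable L (T - τ) (y 0) (y T) (action L T y + ENNReal.ofReal (N * τ)) := by
  obtain ⟨N, A, hN, hAm, hAT, hA0, hAN⟩ := exists_measurable_bounded_double_speed hlsc hT hy
  have hAfin : volume A ≠ ⊤ :=
    ne_top_of_le_ne_top (by simp [Real.volume_Ioc]) (measure_mono hAT)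
  set α := volume.real A with hα
  have hα0 : 0 < α := ENNReal.toReal_pos hA0 hAfin
  have hαT : α ≤ T := by
    have := measureReal_mono (μ := volume) hAT (by simp)
    simpa [hT.le] using this
  refine ⟨N, α / 2, hN, by positivity, fun τ hτ hτ₀ => ?_⟩
  set θ := τ / α with hθ
  have hθ0 : 0 ≤ θ := by positivity
  have hθ1 : θ ≤ 1 / 2 := by rw [hθ, div_le_iff₀ hα0]; linarith
  have hθα : θ * α = τ := by rw [hθ]; field_simp
  set χ : ℝ → ℝ := A.indicator (fun _ => 1) with hχ
  have hχ0 : ∀ s, 0 ≤ χ s := fun s => Set.indicator_nonneg (fun _ _ => zero_le_one) s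
  have hχ1 : ∀ s, χ s ≤ 1 := fun s => Set.indicator_le_self' (fun _ _ => zero_le_one) s
  have hχi : Integrable χ := (integrable_indicator_iff hAm).mpr (integrableOn_const hAfin)
  set σ : ℝ → ℝ := fun s => s - θ * ∫ r in (0 : ℝ)..s, χ r with hσ
  have hσ0 : σ 0 = 0 := by simp [hσ]
  have hσT : σ T = T - τ := by
    have : ∫ r in (0 : ℝ)..T, χ r = α := by
      rw [intervalIntegral.integral_of_le hT.le, hχ, setIntegral_indicator hAm,
        Set.inter_eq_right.mpr hAT]
      simp [hα]
    simp only [hσ, this, hθα]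
  have hdiff : ∀ s s', s ≤ s' → (s' - s) / 2 ≤ σ s' - σ s ∧ σ s' - σ s ≤ s' - s := by
    intro s s' hss
    have h1 : (∫ r in (0 : ℝ)..s', χ r) - ∫ r in (0 : ℝ)..s, χ r = ∫ r in s..s', χ r :=
      intervalIntegral.integral_interval_sub_left hχi.intervalIntegrable hχi.intervalIntegrable
    have h2 : 0 ≤ ∫ r in s..s', χ r := intervalIntegral.integral_nonneg hss fun r _ => hχ0 r
    have h3 : ∫ r in s..s', χ r ≤ s' - s := by
      have := intervalIntegral.integral_mono_on hss (hχi.intervalIntegrable (a := s) (b := s'))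
        (intervalIntegrable_const (c := (1 : ℝ))) fun r _ => hχ1 r
      simpa using this
    have h4 : σ s' - σ s = (s' - s) - θ * ∫ r in s..s', χ r := by
      rw [← h1]; simp only [hσ]; ring
    rw [h4]
    constructor
    · nlinarith
    · have := mul_nonneg hθ0 h2
      linarith
  have hmono : StrictMono σ := fun s s' h => by
    have := (hdiff s s' h.le).1
    linarith
  have hlip : LipschitzWith 1 σ := LipschitzWith.of_dist_le_mul fun s s' => by
    rw [NNReal.coe_one, one_mul, Real.dist_eq, Real.dist_eq]
    rcases le_total s s' with h | h
    · have := hdiff s s' h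
      rw [abs_sub_comm, abs_sub_comm s, abs_of_nonneg (by linarith), abs_of_nonneg (by linarith)]
      exact this.2
    · have := hdiff s' s h
      rw [abs_of_nonneg (by linarith), abs_of_nonneg (by linarith)]
      exact this.2
  have hsurj : Function.Surjective σ := by
    refine hlip.continuous.surjective ?_ ?_
    · refine tendsto_atTop_mono' _ (f₁ := fun s => s / 2) ?_
        (tendsto_id.atTop_div_const (zero_lt_two' ℝ))
      filter_upwards [eventually_ge_atTop 0] with s hs
      have := (hdiff 0 s hs).1
      rw [hσ0] at this
      linarith
    · refine tendsto_atBot_mono' _ (f₁ := fun s => s / 2) ?_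
        (tendsto_id.atBot_div_const (zero_lt_two' ℝ))
      filter_upwards [eventually_le_atBot 0] with s hs
      have := (hdiff s 0 hs).1
      rw [hσ0] at this
      linarith
  obtain ⟨κ, hσκ⟩ := hsurj.hasRightInverse
  have hκσ : ∀ s, κ (σ s) = s := fun s => hmono.injective (hσκ _)
  have hκmono : Monotone κ := fun s s' h => by
    rw [← hmono.le_iff_le, hσκ, hσκ]; exact h
  have hκlip : LipschitzWith 2 κ := LipschitzWith.of_dist_le_mul fun s s' => by
    have hkey : ∀ a b, a ≤ b → κ b - κ a ≤ 2 * (b - a) := fun a b hab => by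
      have := (hdiff (κ a) (κ b) (hκmono hab)).1
      rw [hσκ, hσκ] at this
      linarith
    rw [Real.dist_eq, Real.dist_eq]
    rcases le_total s s' with h | h
    · rw [abs_sub_comm, abs_sub_comm s, abs_of_nonneg (sub_nonneg.mpr (hκmono h)),
        abs_of_nonneg (by linarith)]
      exact hkey _ _ h
    · rw [abs_of_nonneg (sub_nonneg.mpr (hκmono h)), abs_of_nonneg (by linarith)]
      exact hkey _ _ h
  have hκ0 : κ 0 = 0 := by rw [← hσ0, hκσ, hσ0]
  have hκT : κ (T - τ) = T := by rw [← hσT, hκσ]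
  have hTτ : 0 ≤ T - τ := by linarith
  refine ⟨hTτ, fun s => y (κ s), ?_, by simp [hκ0], by simp [hκT], ?_⟩
  · refine hy.comp_monotone_lipschitz hκmono hκlip fun s hs => ?_
    rw [Set.uIcc_of_le hTτ] at hs
    rw [Set.uIcc_of_le hT.le]
    exact ⟨hκ0 ▸ hκmono hs.1, hκT ▸ hκmono hs.2⟩
  have hρ : ∀ᵐ s, HasDerivAt σ (1 - θ * χ s) s := by
    filter_upwards [LocallyIntegrable.ae_hasDerivAt_integral hχi.locallyIntegrable] with s hs
    exact (hasDerivAt_id' s).sub ((hs 0).const_mul θ)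
  have hρ0 : ∀ s, 0 < 1 - θ * χ s := fun s => by nlinarith [hχ0 s, hχ1 s]
  have hle := lintegral_reparam_le (fun z v => ENNReal.ofReal (L z v)) hT.le hy hσ0 hmono hlip
    hκlip.continuous hκσ hσκ hρ hρ0
  rw [hσT] at hle
  refine hle.trans ?_
  have hpt : ∀ s, ENNReal.ofReal (1 - θ * χ s) *
      ENNReal.ofReal (L (y s) ((1 - θ * χ s)⁻¹ • deriv y s)) ≤
      ENNReal.ofReal (L (y s) (deriv y s)) +
        A.indicator (fun _ => ENNReal.ofReal (θ * N)) s := by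
    intro s
    by_cases hs : s ∈ A
    · have hχs : χ s = 1 := by simp [hχ, hs]
      rw [hχs, mul_one, Set.indicator_of_mem hs, ← ENNReal.ofReal_mul (by linarith),
        ← ENNReal.ofReal_add (hnn _ _) (by positivity)]
      refine ENNReal.ofReal_le_ofReal ?_
      have h1θ : 0 < 1 - θ := by linarith
      -- `(1 - θ)⁻¹ v` is the convex combination of `v` and `2 v` with weight `θ / (1 - θ)` on `2 v`.
      have hc := (hconv (y s)).2 (Set.mem_univ (deriv y s))
        (Set.mem_univ ((2 : ℝ) • deriv y s))
        (div_nonneg (by linarith) h1θ.le : 0 ≤ (1 - 2 * θ) / (1 - θ))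
        (div_nonneg hθ0 h1θ.le : 0 ≤ θ / (1 - θ)) (by field_simp; ring)
      have hv : ((1 - 2 * θ) / (1 - θ)) • deriv y s + (θ / (1 - θ)) • (2 : ℝ) • deriv y s =
          (1 - θ)⁻¹ • deriv y s := by
        rw [smul_smul, ← add_smul]
        congr 1
        field_simp
        ring
      rw [hv] at hc
      have hc' := mul_le_mul_of_nonneg_left hc h1θ.le
      have he : (1 - θ) * (((1 - 2 * θ) / (1 - θ)) • L (y s) (deriv y s) +
          (θ / (1 - θ)) • L (y s) ((2 : ℝ) • deriv y s)) =
          (1 - 2 * θ) * L (y s) (deriv y s) + θ * L (y s) ((2 : ℝ) • deriv y s) := by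
        simp only [smul_eq_mul]
        field_simp
      rw [he] at hc'
      have h5 := mul_le_mul_of_nonneg_left (hAN s hs) hθ0
      have h6 := mul_nonneg hθ0 (hnn (y s) (deriv y s))
      linarith
    · have hχs : χ s = 0 := by simp [hχ, hs]
      simp [hχs, hs]
  calc _ ≤ ∫⁻ s in Set.Ioc 0 T, (ENNReal.ofReal (L (y s) (deriv y s)) +
          A.indicator (fun _ => ENNReal.ofReal (θ * N)) s) := lintegral_mono hpt
    _ = action L T y + ∫⁻ s in Set.Ioc 0 T, A.indicator (fun _ => ENNReal.ofReal (θ * N)) s :=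
        lintegral_add_right _ (measurable_const.indicator hAm)
    _ ≤ action L T y + ENNReal.ofReal (N * τ) := by
        gcongr
        rw [lintegral_indicator hAm, setLIntegral_const]
        calc _ ≤ ENNReal.ofReal (θ * N) * volume A := by
              gcongr
              exact Measure.restrict_le_self
          _ = ENNReal.ofReal (N * τ) := by
              rw [← ofReal_measureReal hAfin, ← ENNReal.ofReal_mul (by positivity)]
              congr 1
              rw [← hα, ← hθα]; ring

/-! ### Dynamic programming and the action over short times -/

theorem Steerable.value_le {L : Space n → Space n → ℝ} {φ : Space n → ℝ≥0∞} {t : ℝ}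
    {x b : Space n} {c : ℝ≥0∞} (h : Steerable L t x b c) :
    value L φ (t, x) ≤ ((c + φ b : ℝ≥0∞) : EReal) := by
  obtain ⟨ht, y, hy, hy0, hyt, hc⟩ := h
  refine EReal.coe_ennreal_le_coe_ennreal_iff.mpr ((iInf₂_le y ⟨ht, hy, hy0⟩).trans ?_)
  rw [← hyt]
  exact add_le_add_left hc _

theorem action_add_setLIntegral (L : Space n → Space n → ℝ) (y : ℝ → Space n) {h t : ℝ}
    (h0 : 0 ≤ h) (ht : h ≤ t) :
    action L h y + ∫⁻ s in Set.Ioc h t, ENNReal.ofReal (L (y s) (deriv y s)) = action L t y := by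
  unfold action
  rw [← lintegral_union measurableSet_Ioc
    (Set.disjoint_left.mpr fun s hs hs' => absurd hs.2 (not_le.mpr hs'.1)),
    Set.Ioc_union_Ioc_eq_Ioc h0 ht]

theorem action_mono (L : Space n → Space n → ℝ) (y : ℝ → Space n) {h t : ℝ} (ht : h ≤ t) :
    action L h y ≤ action L t y :=
  lintegral_mono_set (Set.Ioc_subset_Ioc_right ht)

/-- Dynamic programming along an `η`-minimizer, with all quantities finite. -/
theorem exists_real_of_near_minimizer {L : Space n → Space n → ℝ} {φ : Space n → ℝ≥0∞}
    {t h v η : ℝ} {x : Space n} {y : ℝ → Space n} (hy : Admissible t x y)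
    (hcost : cost L φ t y ≤ ENNReal.ofReal (v + η)) (hvη : 0 ≤ v + η) (h0 : 0 ≤ h) (ht : h ≤ t) :
    ∃ a I : ℝ, 0 ≤ a ∧ 0 ≤ I ∧ value L φ (t - h, y h) = (a : EReal) ∧
      action L h y = ENNReal.ofReal I ∧ a + I ≤ v + η := by
  obtain ⟨-, hyac, hy0⟩ := hy
  set W : ℝ≥0∞ := ⨅ (z : ℝ → Space n) (_ : Admissible (t - h) (y h) z), cost L φ (t - h) z with hW
  have hWle : W ≤ (∫⁻ s in Set.Ioc h t, ENNReal.ofReal (L (y s) (deriv y s))) + φ (y t) :=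
    EReal.coe_ennreal_le_coe_ennreal_iff.mp
      (Steerable.of_subarc L hyac h0 ht le_rfl).value_le
  have hsum : W + action L h y ≤ ENNReal.ofReal (v + η) := by
    refine le_trans ?_ hcost
    change _ ≤ action L t y + φ (y t)
    rw [← action_add_setLIntegral L y h0 ht, add_comm W, add_assoc]
    gcongr
  have hWt : W ≠ ⊤ := ne_top_of_le_ne_top ENNReal.ofReal_ne_top (le_self_add.trans hsum)
  have hAt : action L h y ≠ ⊤ := ne_top_of_le_ne_top ENNReal.ofReal_ne_top (le_add_self.trans hsum)
  refine ⟨W.toReal, (action L h y).toReal, ENNReal.toReal_nonneg, ENNReal.toReal_nonneg, ?_,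
    (ENNReal.ofReal_toReal hAt).symm, ?_⟩
  · exact (EReal.coe_ennreal_toReal hWt).symm
  · rw [← ENNReal.toReal_add hWt hAt]
    exact (ENNReal.toReal_mono ENNReal.ofReal_ne_top hsum).trans_eq (ENNReal.toReal_ofReal hvη)

/-- Coercivity makes curves of bounded action equicontinuous at their starting time. -/
theorem Coercive.exists_forall_norm_sub_lt {L : Space n → Space n → ℝ} (hL : Coercive L)
    {B δ : ℝ} (hB : 0 ≤ B) (hδ : 0 < δ) :
    ∃ h₀ : ℝ, 0 < h₀ ∧ ∀ h, h ≤ h₀ → ∀ y : ℝ → Space n,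
      AbsolutelyContinuousOnInterval y 0 h → action L h y ≤ ENNReal.ofReal B →
      ∀ s ∈ Set.Icc 0 h, ‖y s - y 0‖ < δ := by
  obtain ⟨C, hC0, hC⟩ := hL.exists_linear_lower_bound (2 * (B + 1) / δ) (by positivity)
  refine ⟨1 / (C + 1), by positivity, fun h hh y hy hact s hs => ?_⟩
  have hys : AbsolutelyContinuousOnInterval y 0 s := by
    refine hy.mono ?_
    rw [Set.uIcc_of_le hs.1, Set.uIcc_of_le (hs.1.trans hs.2)]
    exact Set.Icc_subset_Icc_right hs.2
  have h1 := (ofReal_displacement_le_action (by positivity) hC hs.1 hys).trans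
    ((action_mono L y hs.2).trans hact)
  rw [ENNReal.ofReal_le_ofReal_iff hB] at h1
  have h2 : C * s ≤ 1 := by
    have h3 : s ≤ 1 / (C + 1) := hs.2.trans hh
    rw [le_div_iff₀ (by positivity)] at h3
    nlinarith [hs.1]
  have h4 : 2 * (B + 1) / δ * ‖y s - y 0‖ ≤ B + 1 := by linarith
  rw [div_mul_eq_mul_div, div_le_iff₀ hδ] at h4
  nlinarith

/-- Lower semicontinuity of the mean action over short times, with respect to the mean velocity. -/
theorem exists_mean_action_lower_bound {L : Space n → Space n → ℝ}
    (hlsc : LowerSemicontinuous (fun q : Space n × Space n => L q.1 q.2))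
    (hconv : ∀ x, ConvexOn ℝ Set.univ (L x)) (hco : Coercive L) (x u : Space n) {ε B : ℝ}
    (hε : 0 < ε) (hB : 0 ≤ B) :
    ∃ l : Space n →L[ℝ] ℝ, ∃ h₀ : ℝ, 0 < h₀ ∧ ∀ h, 0 < h → h ≤ h₀ → ∀ (y : ℝ → Space n) (I : ℝ),
      AbsolutelyContinuousOnInterval y 0 h → y 0 = x → action L h y = ENNReal.ofReal I →
      0 ≤ I → I ≤ B → L x u - ε + l (h⁻¹ • (y h - x) - u) ≤ I / h := by
  obtain ⟨l, δ, hδ, hl⟩ := exists_affine_minorant_near hlsc hconv hco x u hε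
  obtain ⟨h₀, hh₀, hsmall⟩ := hco.exists_forall_norm_sub_lt hB hδ
  refine ⟨l, h₀, hh₀, fun h h0 hh y I hy hy0 hact hI hIB => ?_⟩
  have hs := hsmall h hh y hy (hact.trans_le (ENNReal.ofReal_le_ofReal hIB))
  have h1 := ofReal_le_action_of_affine_le (L := L) (a := L x u - ε - l u) h0.le hy l (by
    intro s hs' v
    have := hl (y s) (by rw [← hy0]; exact hs s (Set.Ioc_subset_Icc_self hs')) v
    rw [map_sub] at this
    linarith)
  rw [hact, ENNReal.ofReal_le_ofReal_iff hI, hy0] at h1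
  rw [le_div_iff₀ h0, map_sub, map_smul, smul_eq_mul]
  have : (L x u - ε + (h⁻¹ * l (y h - x) - l u)) * h = (L x u - ε - l u) * h + l (y h - x) := by
    field_simp
    ring
  linarith

/-- Testing a subgradient along near-minimizers bounds the action over short times from above. -/
theorem exists_action_le_of_mem_subdifferential {L : Space n → Space n → ℝ}
    {φ : Space n → ℝ≥0∞} (hco : Coercive L) {t v : ℝ} (ht : 0 < t) {x : Space n} (hv0 : 0 ≤ v)
    (hv : value L φ (t, x) = (v : EReal)) {p : ℝ × Space n}
    (hp : p ∈ subdifferential (value L φ) t x) {ε : ℝ} (hε : 0 < ε) :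
    ∃ h₀ : ℝ, 0 < h₀ ∧ ∀ h, 0 < h → h ≤ h₀ → ∀ (y : ℝ → Space n) (I : ℝ),
      Admissible t x y → cost L φ t y ≤ ENNReal.ofReal (v + h ^ 2) →
      action L h y = ENNReal.ofReal I → 0 ≤ I →
      I ≤ p.1 * h - inner ℝ p.2 (y h - x) + h ^ 2 + ε * (h + ‖y h - x‖) := by
  obtain ⟨-, -, hlim⟩ := hp
  have hev := eventually_lt_of_lt_liminf
    (lt_of_lt_of_le (show ((-ε : ℝ) : EReal) < 0 by exact_mod_cast neg_lt_zero.mpr hε) hlim)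
  rw [eventually_nhdsWithin_iff, Metric.eventually_nhds_iff] at hev
  obtain ⟨δ, hδ, hev⟩ := hev
  obtain ⟨h₁, hh₁, hsmall⟩ := hco.exists_forall_norm_sub_lt (by linarith : 0 ≤ v + 1) hδ
  refine ⟨min (min h₁ 1) (min t (δ / 2)), by positivity, fun h h0 hh y I hy hcost hI hI0 => ?_⟩
  simp only [le_min_iff] at hh
  obtain ⟨⟨hh1, hh2⟩, hht, hhδ⟩ := hh
  obtain ⟨a, I', ha, hI', hval, hact, hsum⟩ :=
    exists_real_of_near_minimizer hy hcost (by positivity) h0.le hht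
  have hII : I' = I := by
    rw [← ENNReal.toReal_ofReal hI', ← hact, hI, ENNReal.toReal_ofReal hI0]
  subst hII
  have hyh : AbsolutelyContinuousOnInterval y 0 h := by
    refine hy.2.1.mono ?_
    rw [Set.uIcc_of_le h0.le, Set.uIcc_of_le ht.le]
    exact Set.Icc_subset_Icc_right hht
  have hd : ‖y h - x‖ < δ := by
    have hIB : I' ≤ v + 1 := by nlinarith
    have := hsmall h hh1 y hyh (hact.trans_le (ENNReal.ofReal_le_ofReal hIB)) h ⟨h0.le, le_rfl⟩
    rwa [hy.2.2] at this
  have hq := hev (y := (t - h, y h))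
    (by
      rw [Prod.dist_eq, max_lt_iff, Real.dist_eq, dist_eq_norm]
      refine ⟨?_, hd⟩
      rw [sub_sub_cancel_left, abs_neg, abs_of_pos h0]
      linarith)
    (fun hcon => by
      have := congrArg Prod.fst hcon
      simp only at this
      linarith)
  simp only [hval, hv, sub_sub_cancel_left] at hq
  rw [← EReal.coe_sub, ← EReal.coe_sub, ← EReal.coe_div, EReal.coe_lt_coe_iff] at hq
  have hsq0 : 0 < Real.sqrt ((-h) ^ 2 + ‖y h - x‖ ^ 2) := Real.sqrt_pos.mpr 
    (add_pos_of_pos_of_nonneg (by rw [neg_sq]; positivity) (sq_nonneg _))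
  have hsq : Real.sqrt ((-h) ^ 2 + ‖y h - x‖ ^ 2) ≤ h + ‖y h - x‖ := by
    rw [Real.sqrt_le_left (by positivity)]
    nlinarith [norm_nonneg (y h - x)]
  rw [lt_div_iff₀ hsq0] at hq
  have := mul_le_mul_of_nonneg_left hsq hε.le
  linarith

/-! ### Bounds on the mean velocity -/

theorem exists_velocity_bound_of_mem_subdifferential {L : Space n → Space n → ℝ}
    {φ : Space n → ℝ≥0∞} (hco : Coercive L) {t v : ℝ} (ht : 0 < t) {x : Space n} (hv0 : 0 ≤ v)
    (hv : value L φ (t, x) = (v : EReal)) {p : ℝ × Space n}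
    (hp : p ∈ subdifferential (value L φ) t x) :
    ∃ C h₀ : ℝ, 0 < h₀ ∧ ∀ h, 0 < h → h ≤ h₀ → ∀ y : ℝ → Space n,
      Admissible t x y → cost L φ t y ≤ ENNReal.ofReal (v + h ^ 2) → ‖y h - x‖ ≤ C * h := by
  obtain ⟨h₀, hh₀, hact⟩ := exists_action_le_of_mem_subdifferential hco ht hv0 hv hp one_pos
  obtain ⟨C, hC0, hC⟩ := hco.exists_linear_lower_bound (‖p.2‖ + 2) (by positivity)
  refine ⟨C + |p.1| + 2, min h₀ (min 1 t), by positivity, fun h h0 hh y hy hcost => ?_⟩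
  simp only [le_min_iff] at hh
  obtain ⟨hh1, hh2, hht⟩ := hh
  obtain ⟨a, I, -, hI0, -, hI, -⟩ :=
    exists_real_of_near_minimizer hy hcost (by positivity) h0.le hht
  have hub := hact h h0 hh1 y I hy hcost hI hI0
  have hyh : AbsolutelyContinuousOnInterval y 0 h := by
    refine hy.2.1.mono ?_
    rw [Set.uIcc_of_le h0.le, Set.uIcc_of_le ht.le]
    exact Set.Icc_subset_Icc_right hht
  have hlb := (ofReal_displacement_le_action (by positivity) hC h0.le hyh)
  rw [hI, ENNReal.ofReal_le_ofReal_iff hI0, hy.2.2] at hlb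
  have h1 : -inner ℝ p.2 (y h - x) ≤ ‖p.2‖ * ‖y h - x‖ :=
    (neg_le_abs _).trans (abs_real_inner_le_norm _ _)
  have h2 : p.1 * h ≤ |p.1| * h := mul_le_mul_of_nonneg_right (le_abs_self _) h0.le
  have h3 : h ^ 2 ≤ h := by nlinarith
  linarith

/-- A minimizer starts with bounded mean velocity when `L` is bounded near zero velocities:
otherwise it would pay to go to `y h` along a segment at constant speed `r`, which is slower, and
to make up for the lost time by speeding up on `[t/2, t]`. -/
theorem exists_velocity_bound_of_locallyBounded {L : Space n → Space n → ℝ}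
    {φ : Space n → ℝ≥0∞} (hnn : ∀ x u, 0 ≤ L x u)
    (hlsc : LowerSemicontinuous (fun q : Space n × Space n => L q.1 q.2))
    (hconv : ∀ x, ConvexOn ℝ Set.univ (L x)) (hco : Coercive L) (hlb : LocallyBoundedNearZero L)
    {t : ℝ} (ht : 0 < t) {x : Space n} {y : ℝ → Space n} (hmin : IsMinimizer L φ t x y)
    (hfin : cost L φ t y ≠ ⊤) :
    ∃ C h₀ : ℝ, 0 < h₀ ∧ ∀ h, 0 < h → h ≤ h₀ → ‖y h - x‖ ≤ C * h := by
  obtain ⟨⟨-, hyac, hy0⟩, hopt⟩ := hmin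
  obtain ⟨M, hM, r, hr, hMr⟩ := hlb x
  set T := t / 2 with hT
  obtain ⟨-, z, hz, hz0, hzT, hzc⟩ :=
    Steerable.of_subarc L hyac (by linarith : 0 ≤ T) (by linarith : T ≤ t) le_rfl
  obtain ⟨N, τ₀, hN, hτ₀, hsave⟩ :=
    exists_time_saving hnn hlsc hconv (by linarith : 0 < t - T) hz
  rw [hz0, hzT] at hsave
  obtain ⟨C, hC0, hC⟩ := hco.exists_linear_lower_bound ((M + N) / r + 1) (by positivity)
  have hcont : ContinuousWithinAt y (Set.Icc 0 t) 0 := by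
    have := hyac.continuousOn
    rw [Set.uIcc_of_le ht.le] at this
    exact this 0 ⟨le_rfl, ht.le⟩
  obtain ⟨δ, hδ, hnear⟩ := Metric.continuousWithinAt_iff.mp hcont (min r (τ₀ * r)) (by positivity)
  refine ⟨max C r, min T (δ / 2), by positivity, fun h h0 hh => ?_⟩
  simp only [le_min_iff] at hh
  obtain ⟨hhT, hhδ⟩ := hh
  have hd := hnear (x := h) ⟨h0.le, by linarith⟩ (by
    rw [Real.dist_eq, sub_zero, abs_of_pos h0]; linarith)
  rw [dist_eq_norm, hy0, lt_min_iff] at hd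
  rcases le_or_gt ‖y h - x‖ (r * h) with hslow | hfast
  · exact hslow.trans (mul_le_mul_of_nonneg_right (le_max_right _ _) h0.le)
  set d := ‖y h - x‖ with hddef
  have hτ0 : 0 ≤ d / r - h := by
    rw [sub_nonneg, le_div_iff₀ hr]; linarith
  have hττ : d / r - h ≤ τ₀ := by
    rw [sub_le_iff_le_add, div_le_iff₀ hr]; nlinarith
  have hst := ((Steerable.segment hr hMr hd.1.le).trans
    (Steerable.of_subarc L hyac h0.le hhT (by linarith))).trans (hsave _ hτ0 hττ)
  rw [← hddef, show d / r + (T - h) + (t - T - (d / r - h)) = t by ring] at hst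
  obtain ⟨-, w, hw, hw0, hwt, hwc⟩ := hst
  have hle : cost L φ t y ≤ cost L φ t w := hopt w ⟨ht.le, hw, hw0⟩
  set J₁ := ∫⁻ s in Set.Ioc h T, ENNReal.ofReal (L (y s) (deriv y s)) with hJ₁
  set J₂ := ∫⁻ s in Set.Ioc T t, ENNReal.ofReal (L (y s) (deriv y s)) with hJ₂
  have hcy : cost L φ t y = action L h y + (J₁ + J₂ + φ (y t)) := by
    change action L t y + φ (y t) = _
    rw [← action_add_setLIntegral L y (by linarith : 0 ≤ T) (by linarith : T ≤ t),
      ← action_add_setLIntegral L y h0.le hhT]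
    ring
  have hR : J₁ + J₂ + φ (y t) ≠ ⊤ := ne_top_of_le_ne_top hfin (hcy ▸ le_add_self)
  have hcw : cost L φ t w ≤ ENNReal.ofReal ((M + N) * (d / r)) + (J₁ + J₂ + φ (y t)) := by
    change action L t w + φ (w t) ≤ _
    have hNτ : ENNReal.ofReal (M * (d / r)) + ENNReal.ofReal (N * (d / r - h)) ≤
        ENNReal.ofReal ((M + N) * (d / r)) := by
      rw [← ENNReal.ofReal_add (by positivity) (by positivity)]
      refine ENNReal.ofReal_le_ofReal ?_
      nlinarith [mul_nonneg hN h0.le]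
    calc action L t w + φ (w t)
        ≤ (ENNReal.ofReal (M * (d / r)) + J₁ + (J₂ + ENNReal.ofReal (N * (d / r - h)))) +
            φ (y t) := by
          rw [hwt]
          gcongr
          exact hwc.trans (by gcongr)
      _ = (ENNReal.ofReal (M * (d / r)) + ENNReal.ofReal (N * (d / r - h))) +
            (J₁ + J₂ + φ (y t)) := by ring
      _ ≤ _ := by gcongr
  have hact : action L h y ≤ ENNReal.ofReal ((M + N) * (d / r)) :=
    (ENNReal.add_le_add_iff_right hR).mp (hcy ▸ hle.trans hcw)
  have hyh : AbsolutelyContinuousOnInterval y 0 h := by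
    refine hyac.mono ?_
    rw [Set.uIcc_of_le h0.le, Set.uIcc_of_le ht.le]
    exact Set.Icc_subset_Icc_right (by linarith)
  have hlow := (ofReal_displacement_le_action (by positivity) hC h0.le hyh).trans hact
  rw [ENNReal.ofReal_le_ofReal_iff (by positivity), hy0, ← hddef] at hlow
  have : (M + N) / r * d = (M + N) * (d / r) := by ring
  have hdC : d ≤ C * h := by linarith
  exact hdC.trans (mul_le_mul_of_nonneg_right (le_max_left _ _) h0.le)

theorem isBounded_image_difference_quotient {x : Space n} {y : ℝ → Space n} {t C h₀ : ℝ}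
    (hy : ContinuousOn y (Set.Icc 0 t)) (h₀pos : 0 < h₀)
    (hC : ∀ h, 0 < h → h ≤ h₀ → ‖y h - x‖ ≤ C * h) :
    Bornology.IsBounded ((fun h : ℝ => h⁻¹ • (y h - x)) '' Set.Ioc 0 t) := by
  obtain ⟨D, hD⟩ := isCompact_Icc.exists_bound_of_continuousOn hy
  refine isBounded_iff_forall_norm_le.mpr ⟨max C (h₀⁻¹ * (D + ‖x‖)), ?_⟩
  rintro _ ⟨h, hh, rfl⟩
  have h0 : 0 < h := hh.1
  change ‖h⁻¹ • (y h - x)‖ ≤ _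
  rw [norm_smul, norm_inv, Real.norm_of_nonneg h0.le]
  rcases le_total h h₀ with hle | hle
  · refine le_max_of_le_left ?_
    rw [inv_mul_le_iff₀ h0, mul_comm]
    exact hC h h0 hle
  · refine le_max_of_le_right ?_
    have h1 : ‖y h - x‖ ≤ D + ‖x‖ :=
      (norm_sub_le _ _).trans (add_le_add_left (hD h (Set.Ioc_subset_Icc_self hh)) _)
    gcongr

/-! ### Differential inequalities for the value function -/

theorem exists_real_of_value_ne_top {L : Space n → Space n → ℝ} {φ : Space n → ℝ≥0∞} {t : ℝ}
    {x : Space n} (h : value L φ (t, x) ≠ ⊤) :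
    ∃ v : ℝ, 0 ≤ v ∧ value L φ (t, x) = (v : EReal) ∧
      ⨅ (y : ℝ → Space n) (_ : Admissible t x y), cost L φ t y = ENNReal.ofReal v := by
  set W := ⨅ (y : ℝ → Space n) (_ : Admissible t x y), cost L φ t y with hW
  have hWt : W ≠ ⊤ := fun hcon => h (by
    change (W : EReal) = ⊤
    rw [hcon]; rfl)
  exact ⟨W.toReal, ENNReal.toReal_nonneg, (EReal.coe_ennreal_toReal hWt).symm,
    (ENNReal.ofReal_toReal hWt).symm⟩

/-- Along a minimizer, dynamic programming turns the lower bound on the mean action into an upper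
bound on the difference quotients of the value function. -/
theorem lowerContingentDeriv_value_le {L : Space n → Space n → ℝ} {φ : Space n → ℝ≥0∞}
    (hlsc : LowerSemicontinuous (fun q : Space n × Space n => L q.1 q.2))
    (hconv : ∀ x, ConvexOn ℝ Set.univ (L x)) (hco : Coercive L) {t v : ℝ} (ht : 0 < t)
    {x u : Space n} (hv0 : 0 ≤ v) (hv : value L φ (t, x) = (v : EReal)) {y : ℝ → Space n}
    (hy : Admissible t x y) (hcost : cost L φ t y ≤ ENNReal.ofReal v) {h : ℕ → ℝ}
    (hh : Tendsto h atTop (𝓝[>] 0))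
    (hu : Tendsto (fun i => (h i)⁻¹ • (y (h i) - x)) atTop (𝓝 u)) :
    lowerContingentDeriv (value L φ) (t, x) (-1, u) ≤ ((-L x u : ℝ) : EReal) := by
  refine EReal.le_of_forall_lt_iff_le.mp fun c hc => ?_
  have hc' : -L x u < c := by exact_mod_cast hc
  set ε := (c + L x u) / 2 with hε
  have hε0 : 0 < ε := by rw [hε]; linarith
  obtain ⟨l, h₀, hh₀, hmean⟩ := exists_mean_action_lower_bound hlsc hconv hco x u hε0 hv0
  have hpos : ∀ᶠ i in atTop, 0 < h i :=
    (tendsto_nhdsWithin_iff.mp hh).2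
  have hsm : ∀ᶠ i in atTop, h i < min h₀ t :=
    (tendsto_nhdsWithin_iff.mp hh).1.eventually_lt_const (by positivity)
  have hlt : Tendsto (fun i => l ((h i)⁻¹ • (y (h i) - x) - u)) atTop (𝓝 0) := by
    have := (l.continuous.tendsto _).comp (hu.sub_const u)
    simpa [Function.comp_def] using this
  have hl : ∀ᶠ i in atTop, -ε < l ((h i)⁻¹ • (y (h i) - x) - u) :=
    hlt.eventually_const_lt (by linarith)
  have hpt : Tendsto (fun i => (h i, ((-1 : ℝ), (h i)⁻¹ • (y (h i) - x)))) atTop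
      (𝓝[>] (0 : ℝ) ×ˢ 𝓝 ((-1 : ℝ), u)) :=
    hh.prodMk (tendsto_const_nhds.prodMk_nhds hu)
  refine liminf_le_of_frequently_le' (hpt.frequently (Eventually.frequently ?_))
  filter_upwards [hpos, hsm, hl] with i hi hi' hli
  rw [lt_min_iff] at hi'
  obtain ⟨a, I, ha, hI0, hval, hI, hsum⟩ :=
    exists_real_of_near_minimizer (η := 0) hy (by simpa using hcost) (by simpa using hv0)
      hi.le hi'.2.le
  have hyh : AbsolutelyContinuousOnInterval y 0 (h i) := by
    refine hy.2.1.mono ?_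
    rw [Set.uIcc_of_le hi.le, Set.uIcc_of_le ht.le]
    exact Set.Icc_subset_Icc_right hi'.2.le
  have hm := hmean (h i) hi hi'.1.le y I hyh hy.2.2 hI hI0 (by linarith)
  have hpoint : ((t, x) : ℝ × Space n) + h i • ((-1 : ℝ), (h i)⁻¹ • (y (h i) - x)) =
      (t - h i, y (h i)) := by
    ext1
    · simp [sub_eq_add_neg]
    · simp [smul_smul, mul_inv_cancel₀ hi.ne']
  rw [hpoint, hval, hv, ← EReal.coe_sub, ← EReal.coe_div, EReal.coe_le_coe_iff]
  have h1 : (a - v) / h i ≤ -(I / h i) := by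
    rw [← neg_div]
    gcongr
    linarith
  linarith

/-- The supersolution inequality needs no minimizer: an `h²`-minimizer on each time scale `h`
suffices. -/
theorem exists_le_of_mem_subdifferential {L : Space n → Space n → ℝ} {φ : Space n → ℝ≥0∞}
    (hlsc : LowerSemicontinuous (fun q : Space n × Space n => L q.1 q.2))
    (hconv : ∀ x, ConvexOn ℝ Set.univ (L x)) (hco : Coercive L) {t : ℝ} (ht : 0 < t)
    {x : Space n} {p : ℝ × Space n} (hp : p ∈ subdifferential (value L φ) t x) :
    ∃ u : Space n, L x u ≤ p.1 - inner ℝ p.2 u := by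
  obtain ⟨v, hv0, hv, hinf⟩ := exists_real_of_value_ne_top hp.1
  have hex : ∀ i : ℕ, ∃ y : ℝ → Space n, Admissible t x y ∧
      cost L φ t y ≤ ENNReal.ofReal (v + (1 / ((i : ℝ) + 1)) ^ 2) := by
    intro i
    have hlt : ⨅ (y : ℝ → Space n) (_ : Admissible t x y), cost L φ t y <
        ENNReal.ofReal (v + (1 / ((i : ℝ) + 1)) ^ 2) := by
      rw [hinf, ENNReal.ofReal_lt_ofReal_iff (by positivity)]
      have : 0 < (1 / ((i : ℝ) + 1)) ^ 2 := by positivity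
      linarith
    simp only [iInf_lt_iff] at hlt
    obtain ⟨y, hy, hc⟩ := hlt
    exact ⟨y, hy, hc.le⟩
  choose y hy hcost using hex
  set h : ℕ → ℝ := fun i => 1 / ((i : ℝ) + 1) with hh
  have hpos : ∀ i, 0 < h i := fun i => by positivity
  have hlim : Tendsto h atTop (𝓝 0) := tendsto_one_div_add_atTop_nhds_zero_nat
  set w : ℕ → Space n := fun i => (h i)⁻¹ • (y i (h i) - x) with hw
  have hwn : ∀ i, ‖y i (h i) - x‖ = h i * ‖w i‖ := fun i => by
    rw [hw, norm_smul, norm_inv, Real.norm_of_nonneg (hpos i).le,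
      mul_inv_cancel_left₀ (hpos i).ne']
  obtain ⟨C, h₀, hh₀, hC⟩ := exists_velocity_bound_of_mem_subdifferential hco ht hv0 hv hp
  have hbd : ∀ᶠ i in atTop, w i ∈ Metric.closedBall (0 : Space n) C := by
    filter_upwards [hlim.eventually_lt_const hh₀] with i hi
    have := hC (h i) (hpos i) hi.le (y i) (hy i) (hcost i)
    rw [hwn, mul_comm] at this
    simpa using le_of_mul_le_mul_right this (hpos i)
  obtain ⟨u, -, ψ, hψ, hwu⟩ :=
    tendsto_subseq_of_frequently_bounded Metric.isBounded_closedBall hbd.frequently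
  refine ⟨u, ?_⟩
  refine le_of_forall_pos_le_add fun η hη => ?_
  set ε := η / (2 + ‖u‖) with hε
  have hε0 : 0 < ε := by positivity
  obtain ⟨l, h₁, hh₁, hmean⟩ :=
    exists_mean_action_lower_bound hlsc hconv hco x u hε0 (by linarith : 0 ≤ v + 1)
  obtain ⟨h₂, hh₂, hact⟩ := exists_action_le_of_mem_subdifferential hco ht hv0 hv hp hε0
  have hlimψ : Tendsto (fun i => h (ψ i)) atTop (𝓝 0) := hlim.comp hψ.tendsto_atTop
  have hineq : ∀ᶠ i in atTop, L x u - ε + l (w (ψ i) - u) ≤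
      p.1 - inner ℝ p.2 (w (ψ i)) + h (ψ i) + ε * (1 + ‖w (ψ i)‖) := by
    filter_upwards [hlimψ.eventually_lt_const (lt_min hh₁ (lt_min hh₂ (lt_min ht one_pos)))]
      with i hi
    simp only [lt_min_iff] at hi
    set k := ψ i with hk
    obtain ⟨a, I, ha, hI0, -, hI, hsum⟩ :=
      exists_real_of_near_minimizer (hy k) (hcost k) (by positivity) (hpos k).le hi.2.2.1.le
    have hk0 := hpos k
    have hIB : I ≤ v + 1 := by
      have : h k ^ 2 ≤ 1 := by nlinarith [hi.2.2.2]
      change a + I ≤ v + h k ^ 2 at hsum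
      linarith
    have hyh : AbsolutelyContinuousOnInterval (y k) 0 (h k) := by
      refine (hy k).2.1.mono ?_
      rw [Set.uIcc_of_le hk0.le, Set.uIcc_of_le ht.le]
      exact Set.Icc_subset_Icc_right hi.2.2.1.le
    have h1 := hmean (h k) hk0 hi.1.le (y k) I hyh (hy k).2.2 hI hI0 hIB
    have h2 := hact (h k) hk0 hi.2.1.le (y k) I (hy k) (hcost k) hI hI0
    have hin : inner ℝ p.2 (y k (h k) - x) = h k * inner ℝ p.2 (w k) := by
      rw [hw, real_inner_smul_right, mul_inv_cancel_left₀ hk0.ne']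
    rw [hin, hwn] at h2
    refine h1.trans ?_
    rw [div_le_iff₀ hk0]
    linarith
  have hL : Tendsto (fun i => L x u - ε + l (w (ψ i) - u)) atTop (𝓝 (L x u - ε + l (u - u))) :=
    tendsto_const_nhds.add ((l.continuous.tendsto _).comp (hwu.sub_const u))
  have hR : Tendsto (fun i => p.1 - inner ℝ p.2 (w (ψ i)) + h (ψ i) + ε * (1 + ‖w (ψ i)‖)) atTop
      (𝓝 (p.1 - inner ℝ p.2 u + 0 + ε * (1 + ‖u‖))) :=
    ((tendsto_const_nhds.sub (tendsto_const_nhds.inner hwu)).add hlimψ).add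
      (tendsto_const_nhds.mul (tendsto_const_nhds.add hwu.norm))
  have hfinal := le_of_tendsto_of_tendsto hL hR hineq
  rw [sub_self, map_zero] at hfinal
  have : ε * (2 + ‖u‖) = η := by rw [hε]; field_simp
  linarith

end Bolza

theorem proposition3p2 (n : ℕ) (L : Bolza.Space n → Bolza.Space n → ℝ)
    (φ : Bolza.Space n → ℝ≥0∞)
    (hL_nonneg : ∀ x u, 0 ≤ L x u)
    (hL_lsc : LowerSemicontinuous (fun q : Bolza.Space n × Bolza.Space n => L q.1 q.2))
    (hL_convex : ∀ x, ConvexOn ℝ Set.univ (L x))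
    (hL_coercive : Bolza.Coercive L)
    (hφ_lsc : LowerSemicontinuous φ)
    (hφ_proper : ∃ z, φ z ≠ ⊤) :
    (∀ (t : ℝ) (x : Bolza.Space n) (y : ℝ → Bolza.Space n),
      0 < t → Bolza.value L φ (t, x) ≠ ⊤ → Bolza.IsMinimizer L φ t x y →
      ((Bolza.subdifferential (Bolza.value L φ) t x).Nonempty ∨
        Bolza.LocallyBoundedNearZero L) →
      Bornology.IsBounded ((fun h : ℝ => h⁻¹ • (y h - x)) '' Set.Ioc 0 t) ∧
      ∀ (u : Bolza.Space n) (h : ℕ → ℝ), Tendsto h atTop (𝓝[>] 0) →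
        Tendsto (fun i => (h i)⁻¹ • (y (h i) - x)) atTop (𝓝 u) →
        Bolza.lowerContingentDeriv (Bolza.value L φ) (t, x) (-1, u) ≤ ((-L x u : ℝ) : EReal)) ∧
    (∀ (t : ℝ) (x : Bolza.Space n), 0 < t →
      ∀ p ∈ Bolza.subdifferential (Bolza.value L φ) t x,
        0 ≤ (p.1 : EReal) + Bolza.hamiltonian L x (-p.2)) := by
  refine ⟨fun t x y ht hV hmin hcase => ?_, fun t x ht p hp => ?_⟩
  · obtain ⟨v, hv0, hv, hinf⟩ := Bolza.exists_real_of_value_ne_top hV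
    have hcost : Bolza.cost L φ t y ≤ ENNReal.ofReal v := by
      rw [← hinf]
      exact le_iInf₂ hmin.2
    have hbound : ∃ C h₀ : ℝ, 0 < h₀ ∧ ∀ h, 0 < h → h ≤ h₀ → ‖y h - x‖ ≤ C * h := by
      rcases hcase with ⟨p, hp⟩ | hlb
      · obtain ⟨C, h₀, hh₀, hC⟩ :=
          Bolza.exists_velocity_bound_of_mem_subdifferential hL_coercive ht hv0 hv hp
        refine ⟨C, h₀, hh₀, fun h h0 hh => hC h h0 hh y hmin.1 (hcost.trans ?_)⟩
        exact ENNReal.ofReal_le_ofReal (by nlinarith)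
      · exact Bolza.exists_velocity_bound_of_locallyBounded hL_nonneg hL_lsc hL_convex hL_coercive
          hlb ht hmin (ne_top_of_le_ne_top ENNReal.ofReal_ne_top hcost)
    obtain ⟨C, h₀, hh₀, hC⟩ := hbound
    have hcont : ContinuousOn y (Set.Icc 0 t) := by
      have := hmin.1.2.1.continuousOn
      rwa [Set.uIcc_of_le ht.le] at this
    exact ⟨Bolza.isBounded_image_difference_quotient hcont hh₀ hC, fun u h hh hu =>
      Bolza.lowerContingentDeriv_value_le hL_lsc hL_convex hL_coercive ht hv0 hv hmin.1 hcost hh hu⟩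
  · obtain ⟨u, hu⟩ := Bolza.exists_le_of_mem_subdifferential hL_lsc hL_convex hL_coercive ht hp
    have hH : ((inner ℝ (-p.2) u - L x u : ℝ) : EReal) ≤ Bolza.hamiltonian L x (-p.2) :=
      le_iSup (fun u => ((inner ℝ (-p.2) u - L x u : ℝ) : EReal)) u
    calc (0 : EReal) ≤ ((p.1 + (inner ℝ (-p.2) u - L x u) : ℝ) : EReal) := by
          rw [inner_neg_left]
          exact_mod_cast (by linarith : (0 : ℝ) ≤ p.1 + (-inner ℝ p.2 u - L x u))
      _ ≤ (p.1 : EReal) + Bolza.hamiltonian L x (-p.2) := by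
          rw [EReal.coe_add]
          gcongr
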